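/- Let $n\in\mathbb{N}$ and let $A_1,\dots,A_n\in \mathrm{SL}(2,\mathbb{R})$. For $\theta\in\mathbb{R}$ let $R_\theta=\begin{pmatrix}\cos\theta&-\sin\theta\\ \sin\theta&\cos\theta\end{pmatrix}$, and for a real $2\times2$ matrix $M$ of determinant $1$ let $\rho(M)$ be the logarithm of the spectral radius of $M$ (the largest modulus of a complex eigenvalue of $M$). Let $\mathbb{P}^1=\mathbb{R}/\pi\mathbb{Z}$ be the real projective line, where $p$ represents the line spanned by $v_p=(\cos p,\sin p)$, let $dp$ denote integration against the normalized Haar (probability) measure on $\mathbb{P}^1$, and write $\|A\,p\|=\|A\,v_p\|$ with the Euclidean norm. Then $$\frac{1}{2\pi}\int_0^{2\pi}\rho\big(R_\theta A_n\cdots R_\theta A_1\big)\,d\theta=\sum_{j=1}^n\int_{\mathbb{P}^1}\log\|A_j\,p\|\,dp,$$ all integrands being integrable. -/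

import Mathlib

open scoped Matrix

noncomputable section

namespace HAB

/-- The rotation by the angle `θ`, as an element of `SL(2, ℝ)`. -/
def rotation (θ : ℝ) : Matrix.SpecialLinearGroup (Fin 2) ℝ :=
  ⟨!![Real.cos θ, -Real.sin θ; Real.sin θ, Real.cos θ], by
    rw [Matrix.det_fin_two_of]
    nlinarith [Real.sin_sq_add_cos_sq θ]⟩

/-- The logarithm of the spectral radius of a real `2 × 2` matrix. The spectral radius is the
largest modulus of a complex eigenvalue. -/
def logSpectralRadius (M : Matrix.SpecialLinearGroup (Fin 2) ℝ) : ℝ :=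
  Real.log
    (spectralRadius ℂ ((M : Matrix (Fin 2) (Fin 2) ℝ).map (algebraMap ℝ ℂ))).toReal

/-- The product `(R_θ A_n) ⋯ (R_θ A_1)`; the matrix `A_j` is `A (j - 1)`, so the
factor with index `0` stands on the right. -/
def rotatedProduct {n : ℕ} (A : Fin n → Matrix.SpecialLinearGroup (Fin 2) ℝ) (θ : ℝ) :
    Matrix.SpecialLinearGroup (Fin 2) ℝ :=
  (List.ofFn fun j => rotation θ * A j).reverse.prod

instance factPiPos : Fact (0 < Real.pi) := ⟨Real.pi_pos⟩

/-- The real projective line, in the model `ℝ / πℤ`: the class of `p` is the line spanned by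
`(cos p, sin p)`. -/
abbrev ProjLine : Type := AddCircle Real.pi

/-- The vector `A v_p` of the Euclidean plane, with `v_p = (cos p, sin p)`. -/
def imageVec (A : Matrix.SpecialLinearGroup (Fin 2) ℝ) (p : ℝ) : EuclideanSpace ℝ (Fin 2) :=
  WithLp.toLp 2 ((A : Matrix (Fin 2) (Fin 2) ℝ) *ᵥ ![Real.cos p, Real.sin p])

theorem norm_imageVec_periodic (A : Matrix.SpecialLinearGroup (Fin 2) ℝ) :
    Function.Periodic (fun p => ‖imageVec A p‖) Real.pi := by
  intro p
  have h : imageVec A (p + Real.pi) = -imageVec A p := by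
    ext i
    fin_cases i <;> simp [imageVec,
      Real.cos_add_pi, Real.sin_add_pi] <;> ring
  show ‖imageVec A (p + Real.pi)‖ = ‖imageVec A p‖
  rw [h, norm_neg]

/-- `‖A p‖` for a point `p` of the projective line: the Euclidean norm of the image under `A` of
a unit vector on the line `p`. -/
def normOnLine (A : Matrix.SpecialLinearGroup (Fin 2) ℝ) : ProjLine → ℝ :=
  (norm_imageVec_periodic A).lift

end HAB

end

namespace HAB

open Complex Matrix Metric InnerProductSpace MeasureTheory
open scoped ComplexConjugate

/-! With `z = exp (iθ)`, the matrix `z R_θ` is a polynomial `E(z)` that fixes `(1, i)` and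
multiplies `(1, -i)` by `z²`. Replacing `R_θ` by `E(z)` changes the product on the unit circle only
by the unimodular scalar `zⁿ`, so the left side is the circle average of the log of the largest
eigenvalue modulus of the entire product `P(z)`.

For `‖z‖ ≤ 1` no factor of `P(z)` decreases the indefinite form `areaForm`, so the spectral radius
is at least 1 (`one_le_maxRootNorm_of_areaForm_le`). For `‖z‖ < 1` and `n ≥ 1`, `|det P(z)| =
‖z‖^(2n) < 1`, so the two eigenvalues have distinct moduli. The dominant one is then holomorphic on
the disc, its log modulus is harmonic, and the average equals the value at `0`
(`circleAverage_log_maxRootNorm`).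

There `E(0)` is a rank one projection, so `P(0)` has determinant 0 and trace `∏ tr(E(0) A_j)`
(`trace_entireProduct_zero`). A second mean value argument identifies `log ‖tr(E(0) A_j)‖` with the
integral over the projective line (`integral_log_normOnLine`). -/

/-! ### Largest root modulus of a quadratic, and the spectral radius -/

/-- The largest modulus of a root of `X ^ 2 - t X + d`, in a form that is visibly continuous in the
coefficients. -/
noncomputable def maxRootNorm (t d : ℂ) : ℝ :=
  (√(2 * ‖t‖ ^ 2 + 2 * ‖t ^ 2 - 4 * d‖ + 8 * ‖d‖) +
    √(2 * ‖t‖ ^ 2 + 2 * ‖t ^ 2 - 4 * d‖ - 8 * ‖d‖)) / 4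

/-- The discriminant is `(a - b)²`, so by the parallelogram law the two radicands are the squares of
`2(‖a‖ ± ‖b‖)`. -/
theorem maxRootNorm_add_mul (a b : ℂ) : maxRootNorm (a + b) (a * b) = max ‖a‖ ‖b‖ := by
  have hp := parallelogram_law_with_norm ℝ a b
  have hs : (a + b) ^ 2 - 4 * (a * b) = (a - b) ^ 2 := by ring
  have h₁ : 2 * ‖a + b‖ ^ 2 + 2 * ‖(a + b) ^ 2 - 4 * (a * b)‖ + 8 * ‖a * b‖
      = (2 * (‖a‖ + ‖b‖)) ^ 2 := by
    rw [hs, norm_pow, norm_mul]; linear_combination 2 * hp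
  have h₂ : 2 * ‖a + b‖ ^ 2 + 2 * ‖(a + b) ^ 2 - 4 * (a * b)‖ - 8 * ‖a * b‖
      = (2 * (‖a‖ - ‖b‖)) ^ 2 := by
    rw [hs, norm_pow, norm_mul]; linear_combination 2 * hp
  rw [maxRootNorm, h₁, h₂, Real.sqrt_sq (by positivity), Real.sqrt_sq_eq_abs, abs_mul, abs_two]
  rcases le_total ‖a‖ ‖b‖ with h | h
  · rw [max_eq_right h, abs_of_nonpos (sub_nonpos.2 h)]; ring
  · rw [max_eq_left h, abs_of_nonneg (sub_nonneg.2 h)]; ring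

theorem maxRootNorm_zero_right (t : ℂ) : maxRootNorm t 0 = ‖t‖ := by
  simpa using maxRootNorm_add_mul t 0

theorem exists_add_eq_mul_eq (t d : ℂ) : ∃ a b : ℂ, a + b = t ∧ a * b = d := by
  obtain ⟨s, hs⟩ := IsAlgClosed.exists_pow_nat_eq (t ^ 2 - 4 * d) two_pos
  exact ⟨(t + s) / 2, (t - s) / 2, by ring, by linear_combination -hs / 4⟩

theorem maxRootNorm_smul (c t d : ℂ) : maxRootNorm (c * t) (c ^ 2 * d) = ‖c‖ * maxRootNorm t d := by
  obtain ⟨a, b, rfl, rfl⟩ := exists_add_eq_mul_eq t d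
  have := maxRootNorm_add_mul (c * a) (c * b)
  rw [maxRootNorm_add_mul, mul_max_of_nonneg _ _ (norm_nonneg c), ← norm_mul, ← norm_mul, ← this]
  congr 1 <;> ring

theorem continuous_maxRootNorm {X : Type*} [TopologicalSpace X] {t d : X → ℂ}
    (ht : Continuous t) (hd : Continuous d) : Continuous fun x => maxRootNorm (t x) (d x) := by
  unfold maxRootNorm
  fun_prop

theorem spectralRadius_fin_two (M : Matrix (Fin 2) (Fin 2) ℂ) :
    spectralRadius ℂ M = ENNReal.ofReal (maxRootNorm M.trace M.det) := by
  obtain ⟨a, b, ht, hd⟩ := exists_add_eq_mul_eq M.trace M.det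
  have hs : spectrum ℂ M = {a, b} := by
    ext k
    rw [Matrix.mem_spectrum_iff_isRoot_charpoly, Matrix.charpoly_fin_two, ← ht, ← hd]
    have : k ^ 2 - (a + b) * k + a * b = (k - a) * (k - b) := by ring
    simp [Polynomial.IsRoot, this, sub_eq_zero]
  rw [spectralRadius, hs, iSup_insert, iSup_singleton, ← ht, ← hd, maxRootNorm_add_mul,
    ENNReal.ofReal_max, ofReal_norm, ofReal_norm]
  rfl

theorem logSpectralRadius_eq_log_maxRootNorm (M : Matrix.SpecialLinearGroup (Fin 2) ℝ) :
    logSpectralRadius M = Real.log (maxRootNorm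
      ((M : Matrix (Fin 2) (Fin 2) ℝ).map (algebraMap ℝ ℂ)).trace
      ((M : Matrix (Fin 2) (Fin 2) ℝ).map (algebraMap ℝ ℂ)).det) := by
  rw [logSpectralRadius, spectralRadius_fin_two, ENNReal.toReal_ofReal]
  unfold maxRootNorm
  positivity

/-! ### An indefinite form that bounds the spectral radius below -/

/-- The Hermitian form of signature `(1, 1)` preserved by `SL(2, ℝ)`. -/
def areaForm (v : Fin 2 → ℂ) : ℝ := (conj (v 0) * v 1).im

theorem areaForm_eq (v : Fin 2 → ℂ) :
    areaForm v = (v 0).re * (v 1).im - (v 0).im * (v 1).re := by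
  simp only [areaForm, mul_im, conj_re, conj_im]
  ring

section Expanding

attribute [local instance] Matrix.linftyOpNormedRing Matrix.linftyOpNormedAlgebra

/-- If the spectral radius were below 1, Gelfand's formula would give a power of `M` of norm below
1. But the form is 1 at `(1, i)`, stays at least 1 along the orbit, and is bounded by the square of
the sup norm. -/
theorem one_le_maxRootNorm_of_areaForm_le {M : Matrix (Fin 2) (Fin 2) ℂ}
    (hM : ∀ v, areaForm v ≤ areaForm (M *ᵥ v)) : 1 ≤ maxRootNorm M.trace M.det := by
  by_contra! h
  have hr : spectralRadius ℂ M < 1 := by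
    rw [spectralRadius_fin_two]
    exact ENNReal.ofReal_lt_one.2 h
  have hlim := spectrum.pow_nnnorm_pow_one_div_tendsto_nhds_spectralRadius M
  obtain ⟨k, hk, hk0⟩ :=
    ((hlim.eventually_lt_const hr).and (Filter.eventually_gt_atTop 0)).exists
  have hkn : ‖M ^ k‖ < 1 := by
    by_contra! hc
    have : (1 : ENNReal) ≤ ‖M ^ k‖₊ := by exact_mod_cast hc
    exact absurd hk (not_lt.2 (ENNReal.one_le_rpow this (by positivity)))
  set v : Fin 2 → ℂ := ![1, I]
  have hv : ‖v‖ ≤ 1 := by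
    rw [pi_norm_le_iff_of_nonneg zero_le_one]
    intro i
    fin_cases i <;> simp [v]
  have hq : ∀ m : ℕ, 1 ≤ areaForm ((M ^ m) *ᵥ v) := by
    intro m
    induction m with
    | zero => simp [areaForm, v]
    | succ m ih =>
      rw [pow_succ', ← Matrix.mulVec_mulVec]
      exact ih.trans (hM _)
  have hn : ‖(M ^ k) *ᵥ v‖ < 1 :=
    (Matrix.linfty_opNorm_mulVec _ _).trans_lt
      ((mul_le_of_le_one_right (norm_nonneg _) hv).trans_lt hkn)
  have h₁ : areaForm ((M ^ k) *ᵥ v) ≤ ‖(M ^ k) *ᵥ v‖ * ‖(M ^ k) *ᵥ v‖ := by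
    refine ((le_abs_self _).trans (abs_im_le_norm _)).trans ?_
    rw [norm_mul, RCLike.norm_conj]
    exact mul_le_mul (norm_le_pi_norm _ 0) (norm_le_pi_norm _ 1) (norm_nonneg _) (norm_nonneg _)
  nlinarith [hq k, norm_nonneg ((M ^ k) *ᵥ v)]

end Expanding

/-! ### Holomorphic continuation of the rotations -/

/-- The matrix `z R_θ`, `z = exp (i θ)`, continued to an entire function of `z`. -/
noncomputable def entireRotation (z : ℂ) : Matrix (Fin 2) (Fin 2) ℂ :=
  !![(1 + z ^ 2) / 2, I * (z ^ 2 - 1) / 2; -(I * (z ^ 2 - 1) / 2), (1 + z ^ 2) / 2]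

theorem entireRotation_exp (θ : ℝ) : entireRotation (exp (θ * I)) =
    exp (θ * I) • (rotation θ : Matrix (Fin 2) (Fin 2) ℝ).map (algebraMap ℝ ℂ) := by
  have h := Complex.sin_sq_add_cos_sq (θ : ℂ)
  rw [exp_mul_I]
  set c := cos (θ : ℂ) with hc
  set s := sin (θ : ℂ) with hs
  ext i j
  fin_cases i <;> fin_cases j <;>
    simp [entireRotation, rotation, ← hc, ← hs]
  · linear_combination -h / 2 + s ^ 2 / 2 * I_sq
  · linear_combination I / 2 * h + (I * s ^ 2 / 2 + c * s) * I_sq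
  · linear_combination -I / 2 * h - (I * s ^ 2 / 2 + c * s) * I_sq
  · linear_combination -h / 2 + s ^ 2 / 2 * I_sq

theorem det_entireRotation (z : ℂ) : (entireRotation z).det = z ^ 2 := by
  rw [entireRotation, Matrix.det_fin_two_of]
  linear_combination (z ^ 2 - 1) ^ 2 / 4 * I_sq

/-- The vectors `(1, i)` and `(1, -i)` are orthogonal for the form, with values `1` and `-1`. The
first is fixed and the second is multiplied by `z²`, so only the negative part shrinks. -/
theorem areaForm_le_entireRotation {z : ℂ} (hz : ‖z‖ ≤ 1) (v : Fin 2 → ℂ) :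
    areaForm v ≤ areaForm (entireRotation z *ᵥ v) := by
  have key : areaForm (entireRotation z *ᵥ v) =
      areaForm v + (1 - normSq (z ^ 2)) / 4 * normSq (v 0 + I * v 1) := by
    simp only [areaForm_eq, entireRotation, Matrix.mulVec, dotProduct, Fin.sum_univ_two]
    generalize z ^ 2 = w
    simp [normSq_apply]
    ring
  have : normSq (z ^ 2) ≤ 1 := by
    rw [normSq_eq_norm_sq, norm_pow]
    exact pow_le_one₀ (by positivity) (pow_le_one₀ (norm_nonneg z) hz)
  rw [key]
  nlinarith [normSq_nonneg (v 0 + I * v 1)]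

theorem areaForm_specialLinear (A : Matrix.SpecialLinearGroup (Fin 2) ℝ) (v : Fin 2 → ℂ) :
    areaForm ((A : Matrix (Fin 2) (Fin 2) ℝ).map (algebraMap ℝ ℂ) *ᵥ v) = areaForm v := by
  have h := A.det_coe
  rw [Matrix.det_fin_two] at h
  simp only [areaForm_eq, Matrix.mulVec, dotProduct, Fin.sum_univ_two, Matrix.map_apply,
    coe_algebraMap, mul_im, mul_re, add_im, add_re, ofReal_re, ofReal_im]
  linear_combination ((v 0).re * (v 1).im - (v 0).im * (v 1).re) * h

/-! ### Holomorphic dominant root and its mean value property -/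

/-- A holomorphic function without zeros on a disc has a holomorphic square root. -/
theorem exists_differentiableOn_sq_eq {f : ℂ → ℂ} {c : ℂ} {r : ℝ}
    (hf : DifferentiableOn ℂ f (ball c r)) (h0 : ∀ z ∈ ball c r, f z ≠ 0) :
    ∃ s : ℂ → ℂ, DifferentiableOn ℂ s (ball c r) ∧ ∀ z ∈ ball c r, s z ^ 2 = f z := by
  rcases le_or_gt r 0 with hr | hr
  · exact ⟨0, by simp [ball_eq_empty.2 hr]⟩
  have hc : c ∈ ball c r := mem_ball_self hr
  have hd : DifferentiableOn ℂ (fun z => deriv f z / f z) (ball c r) :=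
    (hf.deriv isOpen_ball).div hf h0
  -- The primitive `g` of `f'/f`, normalized at the centre, is a logarithm of `f`; the square root
  -- is `exp (g / 2)`.
  obtain ⟨g, hgc, hg⟩ := hd.isExactOn_ball.with_val_at c (Complex.log (f c))
  have hg' : DifferentiableOn ℂ g (ball c r) := fun z hz =>
    (hg z hz).differentiableAt.differentiableWithinAt
  have hderiv : ∀ z ∈ ball c r, HasDerivAt (fun z => f z * exp (-g z)) 0 z := by
    intro z hz
    have h₁ := (hf.differentiableAt (isOpen_ball.mem_nhds hz)).hasDerivAt
    refine (h₁.mul (hg z hz).neg.cexp).congr_deriv ?_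
    have := h0 z hz
    field_simp
    ring
  have hconst : ∀ z ∈ ball c r, f z * exp (-g z) = 1 := by
    intro z hz
    have := (convex_ball c r).is_const_of_fderivWithin_eq_zero (𝕜 := ℂ)
      (f := fun z => f z * exp (-g z))
      (fun w hw => (hderiv w hw).differentiableAt.differentiableWithinAt)
      (fun w hw => by
        rw [fderivWithin_of_isOpen isOpen_ball hw, (hderiv w hw).hasFDerivAt.fderiv]
        simp) hz hc
    rw [this, hgc, Complex.exp_neg, exp_log (h0 c hc), mul_inv_cancel₀ (h0 c hc)]
  refine ⟨fun z => exp (g z / 2), (hg'.div_const 2).cexp, fun z hz => ?_⟩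
  have := hconst z hz
  rw [Complex.exp_neg, mul_inv_eq_one₀ (exp_ne_zero _)] at this
  simp only [this, ← Complex.exp_nat_mul]
  congr 1
  push_cast
  ring

/-- Where the roots of a quadratic with holomorphic coefficients have distinct moduli throughout a
disc, the largest modulus is that of a holomorphic function. -/
theorem exists_differentiableOn_norm_eq_maxRootNorm {t d : ℂ → ℂ} {c : ℂ} {r : ℝ}
    (ht : DifferentiableOn ℂ t (ball c r)) (hd : DifferentiableOn ℂ d (ball c r))
    (hne : ∀ z ∈ ball c r, ∀ a b, a + b = t z → a * b = d z → ‖a‖ ≠ ‖b‖) :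
    ∃ l : ℂ → ℂ, DifferentiableOn ℂ l (ball c r) ∧
      ∀ z ∈ ball c r, ‖l z‖ = maxRootNorm (t z) (d z) := by
  -- A zero of the discriminant would be a double root, with equal moduli.
  obtain ⟨s, hs, hs2⟩ := exists_differentiableOn_sq_eq (f := fun z => t z ^ 2 - 4 * d z)
    ((ht.pow 2).sub (hd.const_mul 4)) (by
      intro z hz h
      exact hne z hz (t z / 2) (t z / 2) (by ring) (by linear_combination h / 4) rfl)
  have hp : DifferentiableOn ℂ (fun z => (t z + s z) / 2) (ball c r) := (ht.add hs).div_const 2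
  have hm : DifferentiableOn ℂ (fun z => (t z - s z) / 2) (ball c r) := (ht.sub hs).div_const 2
  have hadd : ∀ z, (t z + s z) / 2 + (t z - s z) / 2 = t z := fun z => by ring
  have hmul : ∀ z ∈ ball c r, (t z + s z) / 2 * ((t z - s z) / 2) = d z := fun z hz => by
    linear_combination -hs2 z hz / 4
  have hmax : ∀ z ∈ ball c r,
      maxRootNorm (t z) (d z) = max ‖(t z + s z) / 2‖ ‖(t z - s z) / 2‖ := fun z hz => by
    rw [← maxRootNorm_add_mul, hadd, hmul z hz]
  have hnorm : ∀ z ∈ ball c r, ‖(t z + s z) / 2‖ ≠ ‖(t z - s z) / 2‖ := fun z hz =>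
    hne z hz _ _ (hadd z) (hmul z hz)
  -- The two moduli are continuous and never equal on the connected disc, so the same root dominates
  -- everywhere.
  by_cases hlt : ∃ z ∈ ball c r, ‖(t z + s z) / 2‖ < ‖(t z - s z) / 2‖
  · obtain ⟨w, hw, hlt⟩ := hlt
    refine ⟨_, hm, fun z hz => ?_⟩
    rw [hmax z hz, max_eq_right]
    by_contra! hgt
    obtain ⟨u, hu, he⟩ := (convex_ball c r).isPreconnected.intermediate_value₂ hw hz
      hp.continuousOn.norm hm.continuousOn.norm hlt.le hgt.le
    exact hnorm u hu he
  · push Not at hlt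
    exact ⟨_, hp, fun z hz => by rw [hmax z hz, max_eq_left (hlt z hz)]⟩

/-- The mean value property for the logarithm of the largest modulus of the roots of a quadratic. -/
theorem circleAverage_log_maxRootNorm {t d : ℂ → ℂ} {c : ℂ} {r : ℝ} (hr : 0 < r)
    (ht : Differentiable ℂ t) (hd : Differentiable ℂ d)
    (hne : ∀ z ∈ ball c r, ∀ a b, a + b = t z → a * b = d z → ‖a‖ ≠ ‖b‖)
    (hpos : ∀ z ∈ closedBall c r, maxRootNorm (t z) (d z) ≠ 0) :
    Real.circleAverage (fun z => Real.log (maxRootNorm (t z) (d z))) c r =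
      Real.log (maxRootNorm (t c) (d c)) := by
  obtain ⟨l, hl, hlm⟩ := exists_differentiableOn_norm_eq_maxRootNorm
    ht.differentiableOn hd.differentiableOn hne
  refine InnerProductSpace.HarmonicContOnCl.circleAverage_eq ⟨fun z hz => ?_, ?_⟩
  · rw [abs_of_pos hr] at hz
    have hla : AnalyticAt ℂ l z := hl.analyticAt (isOpen_ball.mem_nhds hz)
    have hl0 : l z ≠ 0 := by
      rw [← norm_ne_zero_iff, hlm z hz]
      exact hpos z (ball_subset_closedBall hz)
    refine (harmonicAt_congr_nhds ?_).1 (hla.harmonicAt_log_norm hl0)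
    filter_upwards [isOpen_ball.mem_nhds hz] with w hw
    simp [hlm w hw]
  -- On the boundary the roots may collide and `l` need not extend; the explicit formula for
  -- `maxRootNorm` is still continuous there.
  · rw [abs_of_pos hr, closure_ball c hr.ne']
    exact (continuous_maxRootNorm ht.continuous hd.continuous).continuousOn.log hpos

/-! ### The entire product, on the circle and at the origin -/

/-- The product `z R_θ A_n ⋯ z R_θ A_1`, `z = exp (i θ)`, continued to an entire function of `z`. -/
noncomputable def entireProduct (L : List (Matrix.SpecialLinearGroup (Fin 2) ℝ)) (z : ℂ) :
    Matrix (Fin 2) (Fin 2) ℂ :=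
  (L.map fun A => entireRotation z * (A : Matrix (Fin 2) (Fin 2) ℝ).map (algebraMap ℝ ℂ)).prod

theorem entireProduct_cons (A : Matrix.SpecialLinearGroup (Fin 2) ℝ)
    (L : List (Matrix.SpecialLinearGroup (Fin 2) ℝ)) (z : ℂ) :
    entireProduct (A :: L) z =
      entireRotation z * (A : Matrix (Fin 2) (Fin 2) ℝ).map (algebraMap ℝ ℂ) *
        entireProduct L z := by
  simp [entireProduct]

theorem det_map_specialLinear (A : Matrix.SpecialLinearGroup (Fin 2) ℝ) :
    ((A : Matrix (Fin 2) (Fin 2) ℝ).map (algebraMap ℝ ℂ)).det = 1 := by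
  have := (algebraMap ℝ ℂ).map_det (A : Matrix (Fin 2) (Fin 2) ℝ)
  rw [A.det_coe, map_one] at this
  exact this.symm

theorem det_entireProduct (L : List (Matrix.SpecialLinearGroup (Fin 2) ℝ)) (z : ℂ) :
    (entireProduct L z).det = (z ^ 2) ^ L.length := by
  induction L with
  | nil => simp [entireProduct]
  | cons A L ih =>
    rw [entireProduct_cons, det_mul, det_mul, det_entireRotation, det_map_specialLinear, ih,
      List.length_cons, pow_succ]
    ring

theorem areaForm_le_entireProduct (L : List (Matrix.SpecialLinearGroup (Fin 2) ℝ)) {z : ℂ}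
    (hz : ‖z‖ ≤ 1) (v : Fin 2 → ℂ) : areaForm v ≤ areaForm (entireProduct L z *ᵥ v) := by
  induction L with
  | nil => simp [entireProduct]
  | cons A L ih =>
    rw [entireProduct_cons, ← mulVec_mulVec, ← mulVec_mulVec]
    refine ih.trans (le_trans ?_ (areaForm_le_entireRotation hz _))
    rw [areaForm_specialLinear]

theorem differentiable_entireProduct (L : List (Matrix.SpecialLinearGroup (Fin 2) ℝ))
    (i j : Fin 2) : Differentiable ℂ fun z => entireProduct L z i j := by
  induction L generalizing i j with
  | nil => simp [entireProduct]
  | cons A L ih =>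
    have hE : ∀ i j, Differentiable ℂ fun z => entireRotation z i j := by
      intro i j
      fin_cases i <;> fin_cases j <;> simp [entireRotation] <;> fun_prop
    simp only [entireProduct_cons, Matrix.mul_apply]
    fun_prop

/-- Since `E = entireRotation 0` is a rank one projection, `E M E = tr(E M) E`. The extra factor `E`
on the right lets the induction start at the empty list. -/
theorem entireProduct_mul_entireRotation_zero
    (L : List (Matrix.SpecialLinearGroup (Fin 2) ℝ)) :
    entireProduct L 0 * entireRotation 0 = (L.map fun A : Matrix.SpecialLinearGroup (Fin 2) ℝ =>
      (entireRotation 0 * (A : Matrix (Fin 2) (Fin 2) ℝ).map (algebraMap ℝ ℂ)).trace).prod •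
        entireRotation 0 := by
  have h00 : entireRotation 0 0 0 = 1 / 2 := by simp [entireRotation]
  have h01 : entireRotation 0 0 1 = -I / 2 := by simp [entireRotation]
  have h10 : entireRotation 0 1 0 = I / 2 := by simp [entireRotation, neg_div]
  have h11 : entireRotation 0 1 1 = 1 / 2 := by simp [entireRotation]
  have key : ∀ M : Matrix (Fin 2) (Fin 2) ℂ,
      entireRotation 0 * M * entireRotation 0 = (entireRotation 0 * M).trace •
        entireRotation 0 := by
    intro M
    ext i j
    fin_cases i <;> fin_cases j <;>
      simp only [Fin.zero_eta, Fin.mk_one, Matrix.smul_apply, smul_eq_mul, trace_fin_two,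
        Matrix.mul_apply, Fin.sum_univ_two, h00, h01, h10, h11]
    · linear_combination -M 1 1 / 4 * I_sq
    · linear_combination M 0 1 / 4 * I_sq
    · linear_combination M 1 0 / 4 * I_sq
    · linear_combination -M 0 0 / 4 * I_sq
  induction L with
  | nil => simp [entireProduct]
  | cons A L ih =>
    rw [entireProduct_cons, mul_assoc, ih, mul_smul_comm, key, smul_smul, List.map_cons,
      List.prod_cons, mul_comm]

/-- Cyclicity of the trace moves the leading `entireRotation 0` to the right end, where the previous
identity applies. The empty product is excluded because its trace is 2. -/
theorem trace_entireProduct_zero {L : List (Matrix.SpecialLinearGroup (Fin 2) ℝ)} (hL : L ≠ []) :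
    (entireProduct L 0).trace = (L.map fun A : Matrix.SpecialLinearGroup (Fin 2) ℝ =>
      (entireRotation 0 * (A : Matrix (Fin 2) (Fin 2) ℝ).map (algebraMap ℝ ℂ)).trace).prod := by
  obtain ⟨A, L, rfl⟩ := List.exists_cons_of_ne_nil hL
  rw [entireProduct_cons, mul_assoc, trace_mul_comm, mul_assoc,
    entireProduct_mul_entireRotation_zero, mul_smul_comm, trace_smul, List.map_cons,
    List.prod_cons, mul_comm, smul_eq_mul, trace_mul_comm]

theorem trace_entireRotation_zero_mul (A : Matrix.SpecialLinearGroup (Fin 2) ℝ) :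
    (entireRotation 0 * (A : Matrix (Fin 2) (Fin 2) ℝ).map (algebraMap ℝ ℂ)).trace =
      ((A 0 0 + A 1 1 : ℝ) + (A 0 1 - A 1 0 : ℝ) * I) / 2 := by
  rw [trace_fin_two, Matrix.mul_apply, Matrix.mul_apply]
  simp [entireRotation, Fin.sum_univ_two]
  ring

/-- The two matrices differ by a scalar of modulus 1, and `maxRootNorm` is homogeneous. -/
theorem maxRootNorm_entireProduct_exp (L : List (Matrix.SpecialLinearGroup (Fin 2) ℝ)) (θ : ℝ) :
    Real.log (maxRootNorm (entireProduct L (exp (θ * I))).trace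
      (entireProduct L (exp (θ * I))).det) =
    logSpectralRadius (L.map fun A => rotation θ * A).prod := by
  have hmul : ∀ A B : Matrix.SpecialLinearGroup (Fin 2) ℝ,
      ((A * B : Matrix.SpecialLinearGroup (Fin 2) ℝ) : Matrix (Fin 2) (Fin 2) ℝ).map
        (algebraMap ℝ ℂ) = (A : Matrix (Fin 2) (Fin 2) ℝ).map (algebraMap ℝ ℂ) *
          (B : Matrix (Fin 2) (Fin 2) ℝ).map (algebraMap ℝ ℂ) := fun A B => Matrix.map_mul
  have h : entireProduct L (exp (θ * I)) = exp (θ * I) ^ L.length •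
      (((L.map fun A => rotation θ * A).prod : Matrix.SpecialLinearGroup (Fin 2) ℝ) :
        Matrix (Fin 2) (Fin 2) ℝ).map (algebraMap ℝ ℂ) := by
    induction L with
    | nil => simp [entireProduct]
    | cons A L ih =>
      rw [entireProduct_cons, ih, entireRotation_exp, List.map_cons, List.prod_cons,
        hmul (rotation θ * A), hmul (rotation θ) A,
        List.length_cons, pow_succ, smul_mul_assoc, smul_mul_assoc, mul_smul_comm, smul_smul,
        mul_comm (exp (θ * I))]
  rw [h, trace_smul, det_smul, Fintype.card_fin, smul_eq_mul, maxRootNorm_smul,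
    norm_pow, norm_exp_ofReal_mul_I, one_pow, one_mul, logSpectralRadius_eq_log_maxRootNorm]

theorem one_le_maxRootNorm_entireProduct (L : List (Matrix.SpecialLinearGroup (Fin 2) ℝ)) {z : ℂ}
    (hz : ‖z‖ ≤ 1) : 1 ≤ maxRootNorm (entireProduct L z).trace (entireProduct L z).det :=
  one_le_maxRootNorm_of_areaForm_le (areaForm_le_entireProduct L hz)

theorem differentiable_trace_entireProduct (L : List (Matrix.SpecialLinearGroup (Fin 2) ℝ)) :
    Differentiable ℂ fun z => (entireProduct L z).trace := by
  simp only [trace_fin_two]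
  exact (differentiable_entireProduct L 0 0).add (differentiable_entireProduct L 1 1)

theorem differentiable_det_entireProduct (L : List (Matrix.SpecialLinearGroup (Fin 2) ℝ)) :
    Differentiable ℂ fun z => (entireProduct L z).det := by
  simp only [det_entireProduct]
  fun_prop

theorem circleAverage_log_maxRootNorm_entireProduct
    {L : List (Matrix.SpecialLinearGroup (Fin 2) ℝ)} (hL : L ≠ []) :
    Real.circleAverage (fun z => Real.log (maxRootNorm (entireProduct L z).trace
      (entireProduct L z).det)) 0 1 =
    (L.map fun A : Matrix.SpecialLinearGroup (Fin 2) ℝ => Real.log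
      ‖(entireRotation 0 * (A : Matrix (Fin 2) (Fin 2) ℝ).map (algebraMap ℝ ℂ)).trace‖).sum := by
  have hlen : L.length ≠ 0 := by simpa using hL
  have hone : ∀ z ∈ closedBall (0 : ℂ) 1,
      1 ≤ maxRootNorm (entireProduct L z).trace (entireProduct L z).det := fun z hz =>
    one_le_maxRootNorm_entireProduct L (by simpa using hz)
  rw [circleAverage_log_maxRootNorm one_pos (differentiable_trace_entireProduct L)
    (differentiable_det_entireProduct L) _ fun z hz => (one_pos.trans_le (hone z hz)).ne']
  · rw [det_entireProduct, zero_pow two_ne_zero, zero_pow hlen, maxRootNorm_zero_right,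
      trace_entireProduct_zero hL]
    -- The lower bound for the one-factor product at `z = 0`, whose determinant is 0, says that this
    -- trace has modulus at least 1.
    have hne : ∀ A : Matrix.SpecialLinearGroup (Fin 2) ℝ,
        (entireRotation 0 * (A : Matrix (Fin 2) (Fin 2) ℝ).map (algebraMap ℝ ℂ)).trace ≠ 0 := by
      intro A h0
      have := one_le_maxRootNorm_entireProduct [A] (z := 0) (by simp)
      rw [det_entireProduct, trace_entireProduct_zero (List.cons_ne_nil A []), List.map_singleton,
        List.prod_singleton, h0] at this
      norm_num [maxRootNorm_zero_right] at this
    clear hL hlen hone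
    induction L with
    | nil => simp
    | cons A L ih =>
      have h2 : (L.map fun A : Matrix.SpecialLinearGroup (Fin 2) ℝ => (entireRotation 0 *
          (A : Matrix (Fin 2) (Fin 2) ℝ).map (algebraMap ℝ ℂ)).trace).prod ≠ 0 := by
        rw [Ne, List.prod_eq_zero_iff, List.mem_map]
        exact fun ⟨B, _, hB⟩ => hne B hB
      rw [List.map_cons, List.prod_cons, norm_mul, Real.log_mul (norm_ne_zero_iff.2 (hne A))
        (norm_ne_zero_iff.2 h2), ih, List.map_cons, List.sum_cons]
  -- Roots of equal modulus would both have modulus at least 1, whereas their product has modulus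
  -- `‖z‖^(2n) < 1`.
  · intro z hz a b hab hmul he
    have hz1 : ‖z‖ < 1 := by simpa using hz
    have h1 := hone z (ball_subset_closedBall hz)
    have hmul' := congrArg norm hmul
    rw [← hab, ← hmul, maxRootNorm_add_mul, he, max_self] at h1
    rw [det_entireProduct, norm_mul, he, norm_pow, norm_pow] at hmul'
    have h2 : (‖z‖ ^ 2) ^ L.length < 1 :=
      pow_lt_one₀ (by positivity) (pow_lt_one₀ (norm_nonneg z) hz1 two_ne_zero) hlen
    nlinarith

/-! ### The integral over the projective line for one matrix -/

theorem normOnLine_coe (A : Matrix.SpecialLinearGroup (Fin 2) ℝ) (p : ℝ) :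
    normOnLine A (p : ProjLine) = ‖imageVec A p‖ :=
  (norm_imageVec_periodic A).lift_coe p

/-- If `A v_p = (x, y)`, the complex number on the right is `exp (ip) (x - iy)`. Only `exp (2ip)`
appears, so the norm becomes that of an affine function on the unit circle. -/
theorem norm_imageVec (A : Matrix.SpecialLinearGroup (Fin 2) ℝ) (p : ℝ) :
    ‖imageVec A p‖ = ‖((A 0 0 + A 1 1 : ℝ) + (A 0 1 - A 1 0 : ℝ) * I) / 2 +
      ((A 0 0 - A 1 1 : ℝ) - (A 0 1 + A 1 0 : ℝ) * I) / 2 * exp ((2 * p : ℝ) * I)‖ := by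
  set c := Real.cos p with hc
  set s := Real.sin p with hs
  have he : exp (p * I) = c + s * I := by rw [exp_mul_I, ← ofReal_cos, ← ofReal_sin]
  have he2 : exp ((2 * p : ℝ) * I) = (c + s * I) ^ 2 := by
    rw [← he, ← Complex.exp_nat_mul]
    congr 1
    push_cast
    ring
  have hcs : (c : ℂ) ^ 2 + (s : ℂ) ^ 2 = 1 := by
    exact_mod_cast (Real.cos_sq_add_sin_sq p)
  have hfac : ((A 0 0 + A 1 1 : ℝ) + (A 0 1 - A 1 0 : ℝ) * I) / 2 +
      ((A 0 0 - A 1 1 : ℝ) - (A 0 1 + A 1 0 : ℝ) * I) / 2 * exp ((2 * p : ℝ) * I) =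
      exp (p * I) * ((A 0 0 * c + A 0 1 * s : ℝ) + (-(A 1 0 * c + A 1 1 * s) : ℝ) * I) := by
    rw [he, he2]
    push_cast
    linear_combination
      (((A 0 0 + A 1 1 : ℂ) + (A 0 1 - A 1 0 : ℂ) * I) / 2 * s ^ 2 - (c + s * I) * s * A 0 1) *
        I_sq - ((A 0 0 + A 1 1 : ℂ) + (A 0 1 - A 1 0 : ℂ) * I) / 2 * hcs
  rw [hfac, norm_mul, norm_exp_ofReal_mul_I, one_mul, norm_add_mul_I, neg_sq, EuclideanSpace.norm_eq]
  simp [imageVec, Fin.sum_univ_two, ← hc, ← hs]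

theorem imageVec_ne_zero (A : Matrix.SpecialLinearGroup (Fin 2) ℝ) (p : ℝ) : imageVec A p ≠ 0 := by
  intro h
  have hdet : IsUnit (A : Matrix (Fin 2) (Fin 2) ℝ).det := by rw [A.det_coe]; exact isUnit_one
  have h' : (A : Matrix (Fin 2) (Fin 2) ℝ) *ᵥ ![Real.cos p, Real.sin p] = 0 := by
    simpa [imageVec] using h
  have h0 := Matrix.eq_zero_of_mulVec_eq_zero hdet.ne_zero h'
  have hc := congrFun h0 0
  have hs := congrFun h0 1
  simp only [Matrix.cons_val_zero, Matrix.cons_val_one, Pi.zero_apply] at hc hs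
  simpa [hc, hs] using Real.sin_sq_add_cos_sq p

theorem continuous_log_normOnLine (A : Matrix.SpecialLinearGroup (Fin 2) ℝ) :
    Continuous fun p : ProjLine => Real.log (normOnLine A p) := by
  refine Continuous.log ?_ fun p => ?_
  · refine continuous_coinduced_dom.2 ?_
    change Continuous fun p : ℝ => normOnLine A (p : ProjLine)
    simp only [normOnLine_coe, norm_imageVec]
    fun_prop
  · induction p using QuotientAddGroup.induction_on with
    | H p =>
      rw [normOnLine_coe]
      exact norm_ne_zero_iff.2 (imageVec_ne_zero A p)

theorem integrable_log_normOnLine (A : Matrix.SpecialLinearGroup (Fin 2) ℝ) :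
    Integrable (fun p : ProjLine => Real.log (normOnLine A p)) AddCircle.haarAddCircle :=
  (continuous_log_normOnLine A).integrable_of_hasCompactSupport
    (HasCompactSupport.of_compactSpace _)

/-- The integrand is `log ‖β + γ w‖` at `w = exp (2ip)`, where `β` is the trace on the right. As
`‖β‖² - ‖γ‖² = det A = 1`, the affine function has no zero in the closed disc, and the mean value is
`log ‖β‖`. -/
theorem integral_log_normOnLine (A : Matrix.SpecialLinearGroup (Fin 2) ℝ) :
    ∫ p : ProjLine, Real.log (normOnLine A p) ∂AddCircle.haarAddCircle =
      Real.log ‖(entireRotation 0 *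
        (A : Matrix (Fin 2) (Fin 2) ℝ).map (algebraMap ℝ ℂ)).trace‖ := by
  have hdet := A.det_coe
  rw [Matrix.det_fin_two] at hdet
  rw [trace_entireRotation_zero_mul]
  have hnorm := norm_imageVec A
  set β : ℂ := ((A 0 0 + A 1 1 : ℝ) + (A 0 1 - A 1 0 : ℝ) * I) / 2 with hβ
  set γ : ℂ := ((A 0 0 - A 1 1 : ℝ) - (A 0 1 + A 1 0 : ℝ) * I) / 2 with hγ
  have hlt : ‖γ‖ < ‖β‖ := by
    rw [← sq_lt_sq₀ (norm_nonneg _) (norm_nonneg _), ← normSq_eq_norm_sq, ← normSq_eq_norm_sq]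
    have : normSq β = normSq γ + 1 := by
      rw [hβ, hγ]
      simp [normSq_apply]
      linear_combination hdet
    linarith
  have hmean : Real.circleAverage (fun w => Real.log ‖β + γ * w‖) 0 1 = Real.log ‖β + γ * 0‖ := by
    refine AnalyticOnNhd.circleAverage_log_norm_of_ne_zero (g := fun w => β + γ * w)
      (fun w _ => by fun_prop) fun w hw h0 => ?_
    have hw1 : ‖w‖ ≤ 1 := by simpa using hw
    have : ‖β‖ = ‖γ‖ * ‖w‖ := by
      rw [← norm_mul, eq_neg_of_add_eq_zero_left h0, norm_neg]
    nlinarith [norm_nonneg γ]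
  rw [mul_zero, add_zero] at hmean
  rw [← hmean, AddCircle.integral_haarAddCircle, ← AddCircle.intervalIntegral_preimage Real.pi 0,
    Real.circleAverage_def, zero_add]
  simp only [normOnLine_coe, hnorm, circleMap, zero_add, ofReal_one, one_mul]
  -- The substitution `θ = 2p` carries one period `[0, π]` of the line onto the full circle.
  rw [intervalIntegral.integral_comp_mul_left
    (fun θ : ℝ => Real.log ‖β + γ * exp (θ * I)‖) two_ne_zero, mul_zero, _root_.mul_inv_rev, smul_smul]

/-! ### The formula for lists of matrices and for families -/

theorem integrable_and_integral_logSpectralRadius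
    (L : List (Matrix.SpecialLinearGroup (Fin 2) ℝ)) :
    IntervalIntegrable (fun θ : ℝ => logSpectralRadius (L.map fun A => rotation θ * A).prod)
      volume 0 (2 * Real.pi) ∧
    1 / (2 * Real.pi) *
        (∫ θ in (0 : ℝ)..(2 * Real.pi), logSpectralRadius (L.map fun A => rotation θ * A).prod) =
      (L.map fun A => ∫ p : ProjLine, Real.log (normOnLine A p) ∂AddCircle.haarAddCircle).sum := by
  simp only [← maxRootNorm_entireProduct_exp, integral_log_normOnLine]
  constructor
  · refine (Continuous.log ?_ fun θ => ?_).intervalIntegrable _ _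
    · have := continuous_maxRootNorm (differentiable_trace_entireProduct L).continuous
        (differentiable_det_entireProduct L).continuous
      exact this.comp (g := fun z => maxRootNorm (entireProduct L z).trace (entireProduct L z).det)
        (f := fun θ : ℝ => exp (θ * I)) (by fun_prop)
    · exact (one_pos.trans_le
        (one_le_maxRootNorm_entireProduct L (norm_exp_ofReal_mul_I θ).le)).ne'
  -- The empty product has determinant 1 throughout, so its eigenvalue moduli are not separated;
  -- here both sides are 0.
  · rcases eq_or_ne L [] with rfl | hL
    · have : maxRootNorm 2 1 = 1 := by
        have := maxRootNorm_add_mul 1 1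
        norm_num at this
        exact this
      simp [entireProduct, this]
    · rw [← circleAverage_log_maxRootNorm_entireProduct hL, Real.circleAverage_def]
      simp [circleMap]

end HAB

theorem theorem3 (n : ℕ) (A : Fin n → Matrix.SpecialLinearGroup (Fin 2) ℝ) :
    IntervalIntegrable (fun θ : ℝ => HAB.logSpectralRadius (HAB.rotatedProduct A θ))
      MeasureTheory.volume 0 (2 * Real.pi) ∧
    (∀ j : Fin n, MeasureTheory.Integrable
      (fun p : HAB.ProjLine => Real.log (HAB.normOnLine (A j) p)) AddCircle.haarAddCircle) ∧
    1 / (2 * Real.pi) *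
        (∫ θ in (0 : ℝ)..(2 * Real.pi), HAB.logSpectralRadius (HAB.rotatedProduct A θ)) =
      ∑ j : Fin n,
        ∫ p : HAB.ProjLine, Real.log (HAB.normOnLine (A j) p) ∂AddCircle.haarAddCircle := by
  have hprod : ∀ θ, HAB.rotatedProduct A θ =
      ((List.ofFn A).reverse.map fun B => HAB.rotation θ * B).prod := fun θ => by
    rw [HAB.rotatedProduct, List.map_reverse, List.map_ofFn]
    rfl
  obtain ⟨h₁, h₂⟩ := HAB.integrable_and_integral_logSpectralRadius (List.ofFn A).reverse
  simp only [hprod]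
  refine ⟨h₁, fun j => HAB.integrable_log_normOnLine (A j), h₂.trans ?_⟩
  rw [List.map_reverse, List.sum_reverse, List.map_ofFn, List.sum_ofFn]
  rfl
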